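/- Let $n\ge 2$. Let $\mathbb B^n$ and $\mathbb S^n$ denote the open unit ball and the unit sphere of $\mathbb C^n$, let $\sigma$ be the rotation-invariant Borel probability measure on $\mathbb S^n$, and let $\mathbb 1=(1,0,\dots,0)$. For $u,v\in\mathbb S^n$ put $d(u,v)=|1-\langle u,v\rangle|$. A nonisotropic ball is a set $Q=\{z\in\mathbb S^n: d(z,\xi)\le r\}$ with $\xi\in\mathbb S^n$ and $r\ge 0$; its radius is $l(Q)=r$. For a function $f$ that is integrable on $\mathbb S^n$ put $$\nu(f,Q)=\inf_{a\in\mathbb C}\frac1{\sigma(Q)}\int_Q|f-a|\,d\sigma ,$$ with $\nu(f,Q)=0$ in the degenerate case $r=0$. Let $C_0>0$ and $B_0$ be given. There is a constant $C>0$, depending only on $n$, $C_0$ and $B_0$, such that the following holds for every $\alpha\in(0,1)$. Let $f$ be holomorphic and zero-free in $\mathbb B^n$ and continuous on the closed ball $\overline{\mathbb B^n}$, and put $\phi=|f|$. Suppose that $$|\phi(t)-\phi(\mathbb 1)|\le C_0\,d(t,\mathbb 1)^{\alpha}\quad\text{for all }t\in\mathbb S^n,\qquad \sup_{\xi\in\mathbb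 S^n}\int_0^{2\pi}\bigl|\log|f(e^{i\theta}\xi)|\bigr|\,d\theta=B_0 .$$ Then: 1. For every nonisotropic ball $Q$ containing $\mathbb 1$, $$\nu(f,Q)\le C\,l(Q)^{\alpha}+\phi(\mathbb 1).$$ 2. If $\phi(\mathbb 1)>0$, then for every nonisotropic ball $Q$ containing $\mathbb 1$ with $l(Q)\le\bigl(\phi(\mathbb 1)/(2C_0)\bigr)^{1/\alpha}$, $$\nu(f,Q)\le C\,l(Q)^{\alpha}+C\,\frac{l(Q)^2}{\phi(\mathbb 1)^{2/\alpha-1}} .$$ -/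

import Mathlib

open MeasureTheory Metric

noncomputable section

namespace BallHolder

/-- The space `ℂⁿ` with its Hermitian norm; the unit ball `𝔹ⁿ` is `ball (0 : Cn n) 1`. -/
abbrev Cn (n : ℕ) : Type := EuclideanSpace ℂ (Fin n)

/-- The unit sphere `𝕊ⁿ` of `ℂⁿ`. -/
abbrev Sph (n : ℕ) : Type := sphere (0 : Cn n) 1

/-- Lebesgue measure on `ℂⁿ`. -/
def lebesgueCn (n : ℕ) : Measure (Cn n) :=
  (volume : Measure (Fin n → ℂ)).map (WithLp.toLp 2)

/-- The standard rotation-invariant Borel probability measure `σ` on the unit sphere of `ℂⁿ`: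
the surface measure induced by Lebesgue measure, divided by its total mass. -/
def sigma (n : ℕ) : Measure (Sph n) :=
  ((lebesgueCn n).toSphere Set.univ)⁻¹ • (lebesgueCn n).toSphere

/-- The distinguished point `(1, 0, …, 0)` of the unit sphere. -/
def pole (n : ℕ) [NeZero n] : Sph n :=
  ⟨EuclideanSpace.single 0 1, by simp⟩

/-- The nonisotropic quasimetric `d(u, v) = |1 - ⟨u, v⟩|`, `⟨u, v⟩ = ∑ uⱼ conj vⱼ`
(Mathlib's inner product is conjugate-linear in its first argument). -/
def qdist {n : ℕ} (u v : Sph n) : ℝ :=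
  ‖1 - inner ℂ (v : Cn n) (u : Cn n)‖

/-- The nonisotropic ball with centre `ξ` and radius `r`. -/
def nonisoBall {n : ℕ} (ξ : Sph n) (r : ℝ) : Set (Sph n) :=
  {z | qdist z ξ ≤ r}

/-- The mean oscillation `ν(f, Q) = inf_{a ∈ ℂ} (1 / σ(Q)) ∫_Q |f - a| dσ`
(with value `0` if `σ(Q) = 0`, which for nonisotropic balls only happens at radius `0`). -/
def meanOsc {n : ℕ} (f : Cn n → ℂ) (Q : Set (Sph n)) : ℝ :=
  ⨅ a : ℂ, ⨍ z in Q, ‖f (z : Cn n) - a‖ ∂(sigma n)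

/-- The slice bound `B₀ = sup_{ξ} ∫_𝕋 |log |f(ξ λ)|| dλ`, as an extended nonnegative number.
(A continuous function on the closed ball that is holomorphic and zero-free in the open ball
vanishes only on a null set of each slice circle, so `Real.log 0 = 0` is immaterial.) -/
def sliceBound {n : ℕ} (f : Cn n → ℂ) : ENNReal :=
  ⨆ ξ : Sph n, ∫⁻ θ in Set.Ioc (0 : ℝ) (2 * Real.pi),
    ENNReal.ofReal |Real.log ‖f (Complex.exp (θ * Complex.I) • (ξ : Cn n))‖|

/-- The standing hypotheses on `f`: holomorphic and without zeros in the open unit ball,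
continuous up to the boundary, and `φ = |f|` satisfies
`|φ(t) - φ(𝟙)| ≤ C₀ d(t, 𝟙)^α` for all `t` in the unit sphere. -/
structure Admissible {n : ℕ} [NeZero n] (α C₀ : ℝ) (f : Cn n → ℂ) : Prop where
  holo : DifferentiableOn ℂ f (ball 0 1)
  cont : ContinuousOn f (closedBall 0 1)
  zero_free : ∀ z ∈ ball (0 : Cn n) 1, f z ≠ 0
  holder : ∀ t : Sph n,
    |‖f (t : Cn n)‖ - ‖f (pole n : Cn n)‖| ≤ C₀ * qdist t (pole n) ^ α

end BallHolder

end

/-! Both claims follow from the stronger bound `ν(f, Q) ≤ C l(Q)^α` for every ball `Q` of radius `r`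
containing the pole (`Admissible.meanOsc_le`). Put `m = |f(𝟙)|` and `δ = 600 C₀ r^α`. If `m < 4δ`,
comparing `f` with `0` is enough. Otherwise `|f|` is within `δ ≤ m/4` of `m` near `Q`, and
zero-freeness turns this control of the modulus into control of `f` itself.

For small `r`, choose a unit vector `ξ` with `⟨𝟙, ξ⟩ = c = 1 - 100r`. The sphere points `t` with
`⟨t, ξ⟩ = τ` bound discs centred at `τξ` and orthogonal to `ξ`. The maximum principle for `f` and
`1/f` carries the modulus bound inside these discs. There `f` is its central value times `exp h`
with `Re h = O(δ/m)` and `h = 0` at the centre. The mean of `h²` vanishes, so `Im h` is as small as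
`Re h` in `L²`, and `f` differs from `f(τξ)` by `O(δ)` on average over the circle
(`orthoDisc_estimate`). The central values form a holomorphic function of `τ` with modulus near `m`
on the disc of radius `100r` about `c`; Borel–Carathéodory makes it constant up to `O(δ)` on the
half disc (`norm_sub_center_le_of_norm_near`).

Averaging over rotations about `ξ` bounds the integral over a `ξ`-invariant set containing `Q`
(`meanOsc_le_of_invariant_set`), and doubling (`exists_sigma_nonisoBall_le`) compares its measure
with that of `Q`. For large `r` the discs through the origin, encoded by `ξ = 0`, cover the whole
sphere. -/

/-! ### One variable: holomorphic functions of almost constant modulus. -/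

theorem Complex.norm_exp_sub_one_le_of_re_le {w : ℂ} {K : ℝ} (hK : 0 ≤ K) (hw : w.re ≤ K) :
    ‖Complex.exp w - 1‖ ≤ Real.exp K * ‖w‖ := by
  have := Convex.norm_image_sub_le_of_norm_hasDerivWithin_le (f := Complex.exp)
    (f' := Complex.exp) (s := {z : ℂ | z.re ≤ K}) (C := Real.exp K) (x := 0) (y := w)
    (fun z _ => (Complex.hasDerivAt_exp z).hasDerivWithinAt)
    (fun z hz => by rw [Complex.norm_exp]; exact Real.exp_le_exp.2 hz)
    (convex_halfSpace_re_le K) (by simpa using hK) hw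
  simpa using this

/-- A zero-free holomorphic function on a disc has a holomorphic logarithm of its quotient
by the central value. -/
theorem exists_log_quotient {g : ℂ → ℂ} {c : ℂ} {ρ : ℝ} (hρ : 0 < ρ)
    (hg : DifferentiableOn ℂ g (ball c ρ)) (h0 : ∀ z ∈ ball c ρ, g z ≠ 0) :
    ∃ h : ℂ → ℂ, DifferentiableOn ℂ h (ball c ρ) ∧ h c = 0 ∧
      ∀ z ∈ ball c ρ, g z = g c * Complex.exp (h z) := by
  have hd : DifferentiableOn ℂ (fun z => deriv g z / g z) (ball c ρ) :=
    (hg.deriv isOpen_ball).div hg h0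
  obtain ⟨h, hc, hh⟩ := hd.isExactOn_ball.with_val_at c 0
  refine ⟨h, fun z hz => (hh z hz).differentiableAt.differentiableWithinAt, hc, fun z hz => ?_⟩
  have key : ∀ w ∈ ball c ρ,
      HasDerivAt (fun w => g w * Complex.exp (-h w)) 0 w := by
    intro w hw
    have h1 := (hg.differentiableAt (isOpen_ball.mem_nhds hw)).hasDerivAt
    have h2 := h1.mul (hh w hw).neg.cexp
    have h3 := h0 w hw
    refine h2.congr_deriv ?_
    field_simp
    ring
  have hconst : g z * Complex.exp (-h z) = g c * Complex.exp (-h c) :=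
    isOpen_ball.is_const_of_deriv_eq_zero (convex_ball c ρ).isPreconnected
      (fun w hw => (key w hw).differentiableAt.differentiableWithinAt)
      (fun w hw => (key w hw).deriv) hz (mem_ball_self hρ)
  rw [hc, neg_zero, Complex.exp_zero, mul_one] at hconst
  rw [← hconst, mul_assoc, ← Complex.exp_add]
  simp

/-- A holomorphic function on a disc of almost constant modulus is the central value times
the exponential of a function with small real part. -/
theorem exists_log_of_norm_near {g : ℂ → ℂ} {c : ℂ} {ρ m δ : ℝ} (hρ : 0 < ρ) (hδ : 0 < δ)
    (hδm : 4 * δ ≤ m) (hg : DifferentiableOn ℂ g (ball c ρ))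
    (hb : ∀ z ∈ ball c ρ, |‖g z‖ - m| ≤ δ) :
    ∃ h : ℂ → ℂ, DifferentiableOn ℂ h (ball c ρ) ∧ h c = 0 ∧
      (∀ z ∈ ball c ρ, |(h z).re| ≤ 3 * δ / m) ∧
      ∀ z ∈ ball c ρ, ‖g z - g c‖ ≤ 4 * m * ‖h z‖ := by
  have hm : 0 < m := by linarith
  have hlow : ∀ z ∈ ball c ρ, m - δ ≤ ‖g z‖ ∧ ‖g z‖ ≤ m + δ := fun z hz => by
    have := abs_le.1 (hb z hz); constructor <;> linarith
  obtain ⟨h, hd, hc, hh⟩ := exists_log_quotient hρ hg (fun z hz => by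
    rw [← norm_pos_iff]; linarith [(hlow z hz).1])
  have hre : ∀ z ∈ ball c ρ, |(h z).re| ≤ 3 * δ / m := by
    intro z hz
    have e1 : ‖g z‖ = ‖g c‖ * Real.exp (h z).re := by
      conv_lhs => rw [hh z hz]
      rw [norm_mul, Complex.norm_exp]
    obtain ⟨a1, a2⟩ := hlow z hz
    obtain ⟨b1, b2⟩ := hlow c (mem_ball_self hρ)
    have hp : 0 < Real.exp (h z).re := Real.exp_pos _
    have hp' : 0 < Real.exp (-(h z).re) := Real.exp_pos _
    have hpp : Real.exp (h z).re * Real.exp (-(h z).re) = 1 := by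
      rw [← Real.exp_add]; simp
    have c1 := Real.add_one_le_exp (h z).re
    have c2 := Real.add_one_le_exp (-(h z).re)
    rw [abs_le]
    have e2 : ‖g c‖ = ‖g z‖ * Real.exp (-(h z).re) := by rw [e1, mul_assoc, hpp, mul_one]
    -- Here `(m + δ)/(m - δ) ≤ 1 + 3δ/m` because `m ≥ 4δ`. Using it for both `exp (Re h)` and its
    -- inverse gives the two-sided bound.
    have hq : ∀ E : ℝ, 0 < E → ∀ p q : ℝ, m - δ ≤ p → q ≤ m + δ → q = p * E →
        E ≤ 1 + 3 * δ / m := by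
      intro E hE p q hp hq hpq
      have : (m - δ) * E ≤ m + δ := by nlinarith
      rw [← sub_le_iff_le_add', le_div_iff₀ hm]
      nlinarith
    have d1 := hq _ hp _ _ b1 a2 e1
    have d2 := hq _ hp' _ _ a1 b2 e2
    constructor <;> linarith
  refine ⟨h, hd, hc, hre, fun z hz => ?_⟩
  have e : g z - g c = g c * (Complex.exp (h z) - 1) := by
    conv_lhs => rw [hh z hz]
    ring
  have h1 : (h z).re ≤ 1 :=
    (le_abs_self _).trans ((hre z hz).trans (by rw [div_le_one hm]; linarith))
  have h2 := Complex.norm_exp_sub_one_le_of_re_le zero_le_one h1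
  rw [e, norm_mul]
  have h3 := (hlow c (mem_ball_self hρ)).2
  have h4 : Real.exp 1 < 3 := by linarith [Real.exp_one_lt_d9]
  have h5 := norm_nonneg (h z)
  calc ‖g c‖ * ‖Complex.exp (h z) - 1‖ ≤ (5 / 4 * m) * (3 * ‖h z‖) := by
        apply mul_le_mul (by linarith) (h2.trans _) (norm_nonneg _) (by positivity)
        exact mul_le_mul_of_nonneg_right h4.le h5
    _ ≤ 4 * m * ‖h z‖ := by nlinarith [mul_nonneg hm.le h5]

/-- On the concentric half disc a holomorphic function of almost constant modulus is almost
constant. -/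
theorem norm_sub_center_le_of_norm_near {g : ℂ → ℂ} {c : ℂ} {ρ m δ : ℝ} (hρ : 0 < ρ) (hδ : 0 < δ)
    (hδm : 4 * δ ≤ m) (hg : DifferentiableOn ℂ g (ball c ρ))
    (hb : ∀ z ∈ ball c ρ, |‖g z‖ - m| ≤ δ) {z : ℂ} (hz : ‖z - c‖ ≤ ρ / 2) :
    ‖g z - g c‖ ≤ 24 * δ := by
  have hm : 0 < m := by linarith
  obtain ⟨h, hd, hc, hre, hgh⟩ := exists_log_of_norm_near hρ hδ hδm hg hb
  have hmap : ∀ w ∈ ball (0 : ℂ) ρ, w + c ∈ ball c ρ := fun w hw => by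
    simpa [mem_ball, dist_eq_norm] using hw
  have hzb : z ∈ ball c ρ := by rw [mem_ball, dist_eq_norm]; linarith
  -- The bound `2M|z - c|/(ρ - |z - c|)` is at most `2M` on the half disc.
  have key := Complex.borelCaratheodory_zero (f := fun w => h (w + c)) (z := z - c) (R := ρ)
    (M := 3 * δ / m) (by positivity)
    (hd.comp (by fun_prop) hmap)
    (fun w hw => (le_abs_self _).trans (hre _ (hmap w hw))) hρ
    (by rw [mem_ball, dist_eq_norm, sub_zero]; linarith) (by simpa using hc)
  simp only [sub_add_cancel] at key
  have h2 : ‖h z‖ ≤ 6 * δ / m := by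
    refine key.trans ?_
    rw [div_le_iff₀ (by linarith)]
    have : 6 * δ / m = 2 * (3 * δ / m) := by ring
    rw [this]
    have hp : 0 ≤ 2 * (3 * δ / m) := by positivity
    apply mul_le_mul_of_nonneg_left _ hp
    linarith
  calc ‖g z - g c‖ ≤ 4 * m * ‖h z‖ := hgh z hzb
    _ ≤ 4 * m * (6 * δ / m) := by gcongr
    _ = 24 * δ := by field_simp; norm_num

/-- The logarithm `h` lives on the open disc only, hence the circle of radius `s < 1`. Since `h²`
has mean `h(0)² = 0`, the squares of `Re h` and `Im h` have equal means, so a bound on `Re h`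
controls `|h|` on average. -/
theorem circleAverage_norm_sub_center_le_of_lt {g : ℂ → ℂ} {m δ s : ℝ} (hδ : 0 < δ)
    (hδm : 4 * δ ≤ m) (hs : 0 < s) (hs1 : s < 1)
    (hg : DifferentiableOn ℂ g (ball 0 1))
    (hb : ∀ z ∈ ball (0 : ℂ) 1, |‖g z‖ - m| ≤ δ) :
    Real.circleAverage (fun z => ‖g z - g 0‖) 0 s ≤ 18 * δ := by
  have hm : 0 < m := by linarith
  obtain ⟨h, hd, hc, hre, hgh⟩ := exists_log_of_norm_near one_pos hδ hδm hg hb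
  have hsub : closedBall (0 : ℂ) s ⊆ ball 0 1 := closedBall_subset_ball hs1
  have hsph : sphere (0 : ℂ) |s| ⊆ ball 0 1 := by
    rw [abs_of_pos hs]; exact sphere_subset_closedBall.trans hsub
  set η := 3 * δ / m with hη
  have hη0 : 0 < η := by positivity
  have hcq : ContinuousOn (fun z => h z ^ 2) (sphere 0 |s|) := (hd.continuousOn.mono hsph).pow 2
  have hmean : Real.circleAverage (fun z => h z ^ 2) 0 s = 0 := by
    have : DiffContOnCl ℂ (fun z => h z ^ 2) (ball 0 |s|) := by
      apply DifferentiableOn.diffContOnCl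
      rw [abs_of_pos hs, closure_ball _ hs.ne']
      exact (hd.mono hsub).pow 2
    rw [this.circleAverage, hc]; simp
  have hci : CircleIntegrable (fun z => h z ^ 2) 0 s := hcq.circleIntegrable'
  have hmeanre : Real.circleAverage (fun z => (h z ^ 2).re) 0 s = 0 := by
    have h1 : ∫ θ in 0..2 * Real.pi, (h (circleMap 0 s θ) ^ 2).re =
        (∫ θ in 0..2 * Real.pi, h (circleMap 0 s θ) ^ 2).re :=
      Complex.reCLM.intervalIntegral_comp_comm hci
    rw [Real.circleAverage_def] at hmean ⊢
    rw [h1]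
    simp only [smul_eq_zero] at hmean
    rcases hmean with h2 | h2
    · rw [h2]; simp
    · rw [h2]; simp
  have hcre : ContinuousOn (fun z => (h z ^ 2).re) (sphere 0 |s|) :=
    Complex.continuous_re.comp_continuousOn hcq
  have hA : CircleIntegrable (fun z => ‖g z - g 0‖) 0 s :=
    ContinuousOn.circleIntegrable' (((hg.continuousOn.mono hsph).sub continuousOn_const).norm)
  have hB : CircleIntegrable (fun _ : ℂ => 6 * m * η) 0 s := by
    simp
  have hC : CircleIntegrable (fun z => (2 * m / η) • (h z ^ 2).re) 0 s :=
    ContinuousOn.circleIntegrable' (hcre.const_smul (2 * m / η))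
  calc Real.circleAverage (fun z => ‖g z - g 0‖) 0 s
      ≤ Real.circleAverage ((fun _ => 6 * m * η) - fun z => (2 * m / η) • (h z ^ 2).re) 0 s := by
        refine Real.circleAverage_mono hA (hB.sub hC) fun z hz => ?_
        refine (hgh z (hsph hz)).trans ?_
        have hu := sq_le_sq' (neg_le_of_abs_le (hre z (hsph hz))) (le_of_abs_le (hre z (hsph hz)))
        have hn : ‖h z‖ ^ 2 = 2 * (h z).re ^ 2 - (h z ^ 2).re := by
          rw [Complex.sq_norm, Complex.normSq_apply, pow_two (h z), Complex.mul_re]; ring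
        -- This is `2|h|η ≤ |h|² + η²` with `|h|² = 2(Re h)² - Re h²`. It is a pointwise bound whose
        -- only non-constant term has mean zero, so no Cauchy–Schwarz for integrals is needed.
        have h3 : 2 * ‖h z‖ * η ≤ 3 * η ^ 2 - (h z ^ 2).re := by
          nlinarith [sq_nonneg (‖h z‖ - η)]
        simp only [Pi.sub_apply, smul_eq_mul]
        have h4 : 6 * m * η - 2 * m / η * (h z ^ 2).re =
            2 * m / η * (3 * η ^ 2 - (h z ^ 2).re) := by field_simp; ring
        rw [h4]
        calc 4 * m * ‖h z‖ = 2 * m / η * (2 * ‖h z‖ * η) := by field_simp; ring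
          _ ≤ _ := mul_le_mul_of_nonneg_left h3 (by positivity)
    _ = 18 * δ := by
        rw [Real.circleAverage_sub hB hC, Real.circleAverage_const]
        have : Real.circleAverage (fun z => (2 * m / η) • (h z ^ 2).re) 0 s =
            (2 * m / η) • Real.circleAverage (fun z => (h z ^ 2).re) 0 s :=
          Real.circleAverage_fun_smul
        rw [this, hmeanre, smul_zero, sub_zero, hη]
        field_simp
        norm_num

/-- A holomorphic function on the unit disc of almost constant modulus has small mean oscillation
over the unit circle. -/
theorem circleAverage_norm_sub_center_le {g : ℂ → ℂ} {m δ : ℝ} (hδ : 0 < δ)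
    (hδm : 4 * δ ≤ m) (hg : DifferentiableOn ℂ g (ball 0 1))
    (hgc : ContinuousOn g (closedBall 0 1))
    (hb : ∀ z ∈ closedBall (0 : ℂ) 1, |‖g z‖ - m| ≤ δ) :
    Real.circleAverage (fun z => ‖g z - g 0‖) 0 1 ≤ 18 * δ := by
  have hmem : ∀ s ∈ Set.Ioo (0 : ℝ) 1, ∀ θ, circleMap 0 s θ ∈ closedBall (0 : ℂ) 1 := by
    intro s hs θ
    simp [abs_of_pos hs.1, hs.2.le]
  have hmem1 : ∀ θ, circleMap 0 1 θ ∈ closedBall (0 : ℂ) 1 := fun θ => by simp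
  have hlim : Filter.Tendsto (fun s => Real.circleAverage (fun z => ‖g z - g 0‖) 0 s)
      (nhdsWithin 1 (Set.Ioo 0 1)) (nhds (Real.circleAverage (fun z => ‖g z - g 0‖) 0 1)) := by
    simp only [Real.circleAverage_def]
    apply Filter.Tendsto.const_smul
    apply intervalIntegral.tendsto_integral_filter_of_dominated_convergence (fun _ => 2 * (m + δ))
    · filter_upwards [self_mem_nhdsWithin] with s hs
      refine Continuous.aestronglyMeasurable ?_
      refine ((hgc.comp_continuous (continuous_circleMap 0 s) (hmem s hs)).sub
        continuous_const).norm
    · filter_upwards [self_mem_nhdsWithin] with s hs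
      refine Filter.Eventually.of_forall fun θ _ => ?_
      rw [norm_norm]
      refine (norm_sub_le _ _).trans ?_
      have h1 := (abs_le.1 (hb _ (hmem s hs θ))).2
      have h2 := (abs_le.1 (hb 0 (by simp))).2
      linarith
    · simp
    · refine Filter.Eventually.of_forall fun θ _ => ?_
      have h1 : Filter.Tendsto (fun s => circleMap 0 s θ) (nhdsWithin 1 (Set.Ioo 0 1))
          (nhdsWithin (circleMap 0 1 θ) (closedBall 0 1)) := by
        refine tendsto_nhdsWithin_iff.2 ⟨?_, ?_⟩
        · have : Continuous fun s : ℝ => circleMap 0 s θ := by unfold circleMap; fun_prop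
          exact this.continuousAt.tendsto.mono_left nhdsWithin_le_nhds
        · filter_upwards [self_mem_nhdsWithin] with s hs using hmem s hs θ
      exact (((hgc _ (hmem1 θ)).tendsto.comp h1).sub_const (g 0)).norm
  have : (nhdsWithin (1 : ℝ) (Set.Ioo 0 1)).NeBot := by
    rw [← mem_closure_iff_nhdsWithin_neBot, closure_Ioo zero_ne_one]; simp
  refine le_of_tendsto hlim ?_
  filter_upwards [self_mem_nhdsWithin] with s hs
  exact circleAverage_norm_sub_center_le_of_lt hδ hδm hs.1 hs.2 hg
    fun z hz => hb z (ball_subset_closedBall hz)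

/-- The modulus of a zero-free holomorphic function on the unit disc obeys on the closed disc
the bounds it obeys on the circle. -/
theorem norm_near_of_norm_near_sphere {g : ℂ → ℂ} {m δ : ℝ} (hδm : δ < m)
    (hg : DifferentiableOn ℂ g (ball 0 1)) (hgc : ContinuousOn g (closedBall 0 1))
    (h0 : ∀ z ∈ ball (0 : ℂ) 1, g z ≠ 0)
    (hb : ∀ z ∈ sphere (0 : ℂ) 1, |‖g z‖ - m| ≤ δ) :
    ∀ z ∈ closedBall (0 : ℂ) 1, |‖g z‖ - m| ≤ δ := by
  have hcl : closure (ball (0 : ℂ) 1) = closedBall 0 1 := closure_ball _ one_ne_zero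
  have hfr : frontier (ball (0 : ℂ) 1) = sphere 0 1 := frontier_ball _ one_ne_zero
  have h0' : ∀ z ∈ closedBall (0 : ℂ) 1, g z ≠ 0 := by
    intro z hz
    rcases (mem_closedBall.1 hz).lt_or_eq with h | h
    · exact h0 z h
    · have := (abs_le.1 (hb z h)).1
      rw [← norm_pos_iff]; linarith
  have hgd : DiffContOnCl ℂ g (ball 0 1) := ⟨hg, hcl ▸ hgc⟩
  intro z hz
  rw [← hcl] at hz
  have hup : ‖g z‖ ≤ m + δ :=
    Complex.norm_le_of_forall_mem_frontier_norm_le isBounded_ball hgd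
      (fun w hw => by rw [hfr] at hw; linarith [(abs_le.1 (hb w hw)).2]) hz
  -- The lower bound is the maximum principle for `1/g`; this is where zero-freeness enters.
  have hlo : ‖(g z)⁻¹‖ ≤ (m - δ)⁻¹ :=
    Complex.norm_le_of_forall_mem_frontier_norm_le isBounded_ball
      (hgd.inv (by rw [hcl]; exact h0'))
      (fun w hw => by
        rw [hfr] at hw
        rw [Pi.inv_apply, norm_inv]
        exact inv_anti₀ (by linarith) (by linarith [(abs_le.1 (hb w hw)).1])) hz
  rw [norm_inv] at hlo
  have := (inv_le_inv₀ (norm_pos_iff.2 (h0' z (hcl ▸ hz))) (by linarith)).1 hlo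
  rw [abs_le]; constructor <;> linarith

/-! ### Unitary invariance of `σ` and doubling for nonisotropic balls. -/

noncomputable section

namespace BallHolder

open scoped Pointwise

variable {n : ℕ}

theorem lebesgueCn_apply (A : Set (Cn n)) :
    lebesgueCn n A = volume (WithLp.toLp 2 ⁻¹' A : Set (Fin n → ℂ)) :=
  (MeasurableEquiv.toLp 2 (Fin n → ℂ)).map_apply A

instance isAddHaarMeasure_lebesgueCn : (lebesgueCn n).IsAddHaarMeasure :=
  (PiLp.continuousLinearEquiv 2 ℝ (fun _ : Fin n => ℂ)).symm.isAddHaarMeasure_map volume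

/-- The image measure is again a Haar measure, hence a multiple of the original; the unit ball is
preserved, so the factor is `1`. -/
theorem measurePreserving_isometry (U : Cn n ≃ₗᵢ[ℂ] Cn n) :
    MeasurePreserving U (lebesgueCn n) (lebesgueCn n) := by
  refine ⟨U.continuous.measurable, ?_⟩
  have hm : ((lebesgueCn n).map U).IsAddHaarMeasure :=
    (U.toContinuousLinearEquiv.restrictScalars ℝ).isAddHaarMeasure_map (lebesgueCn n)
  have h := Measure.isAddLeftInvariant_eq_smul ((lebesgueCn n).map U) (lebesgueCn n)
  set c := Measure.addHaarScalarFactor ((lebesgueCn n).map U) (lebesgueCn n)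
  have hb : (lebesgueCn n).map U (ball 0 1) = lebesgueCn n (ball 0 1) := by
    rw [Measure.map_apply U.continuous.measurable measurableSet_ball]
    congr 1
    ext z
    simp
  rw [h, Measure.smul_apply] at hb
  have h0 : lebesgueCn n (ball 0 1) ≠ 0 := (measure_ball_pos _ _ one_pos).ne'
  have h1 : lebesgueCn n (ball 0 1) ≠ ⊤ := measure_ball_lt_top.ne
  have hc : c = 1 := by
    have := congrArg ENNReal.toReal hb
    rw [ENNReal.smul_def, smul_eq_mul, ENNReal.toReal_mul] at this
    have h2 : (lebesgueCn n (ball 0 1)).toReal ≠ 0 := ENNReal.toReal_ne_zero.2 ⟨h0, h1⟩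
    have h3 := mul_right_cancel₀ h2 (this.trans (one_mul _).symm)
    exact NNReal.coe_injective (by simpa using h3)
  rw [h, hc, one_smul]

/-- The action of a unitary map on the unit sphere. -/
def sphereMap (U : Cn n ≃ₗᵢ[ℂ] Cn n) (t : Sph n) : Sph n :=
  ⟨U t, by simp⟩

@[simp]
theorem coe_sphereMap (U : Cn n ≃ₗᵢ[ℂ] Cn n) (t : Sph n) : (sphereMap U t : Cn n) = U t := rfl

theorem continuous_sphereMap (U : Cn n ≃ₗᵢ[ℂ] Cn n) : Continuous (sphereMap U) :=
  (U.continuous.comp continuous_subtype_val).subtype_mk _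

theorem measurePreserving_sphereMap (U : Cn n ≃ₗᵢ[ℂ] Cn n) :
    MeasurePreserving (sphereMap U) (sigma n) (sigma n) := by
  have hU := (continuous_sphereMap U).measurable
  refine ⟨hU, Measure.ext fun s hs => ?_⟩
  rw [Measure.map_apply hU hs, sigma, Measure.smul_apply, Measure.smul_apply,
    Measure.toSphere_apply' _ hs, Measure.toSphere_apply' _ (hU hs)]
  congr 2
  have : (Set.Ioo (0 : ℝ) 1 • (Subtype.val '' (sphereMap U ⁻¹' s)) : Set (Cn n)) =
      U.toHomeomorph.toMeasurableEquiv ⁻¹' (Set.Ioo (0 : ℝ) 1 • (Subtype.val '' s)) := by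
    ext z
    simp only [Set.mem_smul, Set.mem_preimage, Set.mem_image, Homeomorph.toMeasurableEquiv_coe,
      LinearIsometryEquiv.coe_toHomeomorph]
    constructor
    · rintro ⟨a, ha, _, ⟨t, ht, rfl⟩, rfl⟩
      exact ⟨a, ha, _, ⟨_, ht, rfl⟩, by
        rw [coe_sphereMap, ← Complex.coe_smul, ← Complex.coe_smul, map_smul]⟩
    · rintro ⟨a, ha, _, ⟨t, ht, rfl⟩, h⟩
      refine ⟨a, ha, _, ⟨sphereMap U.symm t, ?_, rfl⟩, ?_⟩
      · have : sphereMap U (sphereMap U.symm t) = t := by ext1; simp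
        rwa [this]
      · apply U.injective
        rw [← h, coe_sphereMap, ← Complex.coe_smul, ← Complex.coe_smul, map_smul]
        simp
  rw [this]
  exact (show MeasurePreserving U.toHomeomorph.toMeasurableEquiv _ _ from
    measurePreserving_isometry U).measure_preimage_equiv _

theorem continuous_qdist (ξ : Sph n) : Continuous fun t : Sph n => qdist t ξ := by
  unfold qdist
  fun_prop

theorem measurableSet_nonisoBall (ξ : Sph n) (r : ℝ) : MeasurableSet (nonisoBall ξ r) :=
  (isClosed_le (continuous_qdist ξ) continuous_const).measurableSet

variable [NeZero n]

theorem inner_pole (z : Cn n) : inner ℂ (pole n : Cn n) z = z 0 := by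
  simp [pole, EuclideanSpace.inner_single_left]

/-- Extending `ξ` to an orthonormal basis gives a unitary map taking `ξ` to the pole. -/
theorem sigma_nonisoBall_eq_pole (ξ : Sph n) (r : ℝ) :
    sigma n (nonisoBall ξ r) = sigma n (nonisoBall (pole n) r) := by
  obtain ⟨b, hb⟩ := Orthonormal.exists_orthonormalBasis_extension_of_card_eq (𝕜 := ℂ)
    (E := Cn n) (ι := Fin n) (by simp) (v := fun _ => (ξ : Cn n)) (s := {0}) (by
      constructor
      · intro i; simp
      · intro i j hij; exact absurd (Subsingleton.elim i j) hij)
  have hb0 : b 0 = ξ := hb 0 rfl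
  have hU : b.repr ξ = (pole n : Cn n) := by
    rw [← hb0, b.repr_self]; rfl
  rw [eq_comm, ← (measurePreserving_sphereMap b.repr).measure_preimage
    (measurableSet_nonisoBall _ _).nullMeasurableSet]
  congr 1
  ext t
  simp only [nonisoBall, qdist, Set.mem_ofPred_eq, Set.mem_preimage, coe_sphereMap]
  rw [← hU, b.repr.inner_map_map]

theorem volume_reProdIm_Icc {a b c d : ℝ} :
    volume (Set.Icc a b ×ℂ Set.Icc c d) = ENNReal.ofReal (b - a) * ENNReal.ofReal (d - c) := by
  have := Complex.volume_preserving_equiv_real_prod.measure_preimage_equiv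
    (Set.Icc a b ×ˢ Set.Icc c d)
  rw [Measure.volume_eq_prod, Measure.prod_prod, Real.volume_Icc, Real.volume_Icc] at this
  exact this

/-- The product of a rectangle in the first coordinate and discs in the others. -/
def polyBox (n : ℕ) [NeZero n] (a b h R : ℝ) : Set (Fin n → ℂ) :=
  Set.univ.pi fun i => if i = 0 then Set.Icc a b ×ℂ Set.Icc (-h) h else closedBall 0 R

theorem volume_polyBox_le {a b h R a' b' h' R' : ℝ} {K : NNReal}
    (h1 : (b - a) * (2 * h) ≤ K * ((b' - a') * (2 * h'))) (h2 : R ^ 2 ≤ K * R' ^ 2)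
    (hab : a ≤ b) (hab' : a' ≤ b') (hR : 0 ≤ R) (hR' : 0 ≤ R') :
    volume (polyBox n a b h R) ≤ (K : ENNReal) ^ n * volume (polyBox n a' b' h' R') := by
  rw [polyBox, polyBox, volume_pi_pi, volume_pi_pi]
  have : (K : ENNReal) ^ n = ∏ _i : Fin n, (K : ENNReal) := by simp
  rw [this, ← Finset.prod_mul_distrib]
  refine Finset.prod_le_prod' fun i _ => ?_
  split_ifs
  · rw [volume_reProdIm_Icc, volume_reProdIm_Icc, ← ENNReal.ofReal_mul (by linarith),
      ← ENNReal.ofReal_mul (by linarith), ← ENNReal.ofReal_coe_nnreal,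
      ← ENNReal.ofReal_mul K.coe_nonneg]
    apply ENNReal.ofReal_le_ofReal
    have e1 : h - -h = 2 * h := by ring
    have e2 : h' - -h' = 2 * h' := by ring
    rw [e1, e2]; exact h1
  · rw [Complex.volume_closedBall, Complex.volume_closedBall, ← mul_assoc]
    gcongr
    rw [← ENNReal.ofReal_coe_nnreal, ← ENNReal.ofReal_pow hR, ← ENNReal.ofReal_pow hR',
      ← ENNReal.ofReal_mul K.coe_nonneg]
    exact ENNReal.ofReal_le_ofReal h2

theorem norm_sq_eq_add_sum (z : Cn n) :
    ‖z‖ ^ 2 = ‖z 0‖ ^ 2 + ∑ i ∈ Finset.univ.erase 0, ‖z i‖ ^ 2 := by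
  rw [EuclideanSpace.norm_sq_eq, Finset.add_sum_erase _ (fun i => ‖z i‖ ^ 2) (Finset.mem_univ 0)]

/-- Since `|t₀| ≥ 1 - r`, each remaining coordinate satisfies `|tᵢ|² ≤ 1 - |t₀|² ≤ 2r`. Since
`toSphere` is defined through cones, this bounds the measure of the ball from above. -/
theorem cone_nonisoBall_subset {r : ℝ} (hr : 0 ≤ r) :
    WithLp.toLp 2 ⁻¹' (Set.Ioo (0 : ℝ) 1 • (Subtype.val '' (nonisoBall (pole n) r)) : Set (Cn n)) ⊆
      polyBox n (-1) 1 r (Real.sqrt (2 * r)) := by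
  intro z hz
  obtain ⟨s, hs, _, ⟨t, ht, rfl⟩, hst⟩ := hz
  have hzi : ∀ i, z i = s * (t : Cn n) i := fun i => by
    have := congrArg (fun w : Cn n => w i) hst
    simpa using this.symm
  have ht1 : ‖(t : Cn n)‖ = 1 := by simp
  have hd : ‖1 - (t : Cn n) 0‖ ≤ r := by
    have : qdist t (pole n) ≤ r := ht
    rwa [qdist, inner_pole] at this
  have hsum := norm_sq_eq_add_sum (t : Cn n)
  rw [ht1] at hsum
  have hre := Complex.abs_re_le_norm (1 - (t : Cn n) 0)
  have him := Complex.abs_im_le_norm (1 - (t : Cn n) 0)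
  simp only [Complex.sub_re, Complex.one_re, Complex.sub_im, Complex.one_im, zero_sub,
    abs_neg] at hre him
  have ht0 : ‖(t : Cn n) 0‖ ≤ 1 := (PiLp.norm_apply_le (t : Cn n) 0).trans_eq ht1
  have hre0 := Complex.abs_re_le_norm ((t : Cn n) 0)
  rw [polyBox, Set.mem_univ_pi]
  intro i
  split_ifs with hi
  · subst hi
    rw [Complex.mem_reProdIm, hzi, Complex.re_ofReal_mul, Complex.im_ofReal_mul]
    have a1 := abs_le.1 (hre0.trans ht0)
    have a2 := abs_le.1 (him.trans hd)
    refine ⟨⟨?_, ?_⟩, ⟨?_, ?_⟩⟩ <;> nlinarith [hs.1, hs.2]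
  · rw [mem_closedBall, dist_zero_right, hzi, norm_mul, Complex.norm_real, Real.norm_eq_abs,
      abs_of_pos hs.1]
    have h1 : ‖(t : Cn n) i‖ ^ 2 ≤ ∑ i ∈ Finset.univ.erase 0, ‖(t : Cn n) i‖ ^ 2 :=
      Finset.single_le_sum (f := fun i => ‖(t : Cn n) i‖ ^ 2) (fun _ _ => sq_nonneg _)
        (Finset.mem_erase.2 ⟨hi, Finset.mem_univ i⟩)
    have h2 : 1 - r ≤ ‖(t : Cn n) 0‖ := by
      have := norm_sub_norm_le (1 : ℂ) ((t : Cn n) 0)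
      rw [norm_one] at this; linarith
    have h3 : ‖(t : Cn n) i‖ ≤ Real.sqrt (2 * r) := by
      apply Real.le_sqrt_of_sq_le
      nlinarith
    calc s * ‖(t : Cn n) i‖ ≤ 1 * ‖(t : Cn n) i‖ := by gcongr; exact hs.2.le
      _ ≤ _ := by rwa [one_mul]

theorem polyBox_subset_cone {r : ℝ} (hr : 0 < r) (hr1 : r ≤ 1) :
    polyBox n (1 / 4) (1 / 2) (r / 20) (Real.sqrt (r / (20 * n))) ⊆
      WithLp.toLp 2 ⁻¹' (Set.Ioo (0 : ℝ) 1 • (Subtype.val '' (nonisoBall (pole n) r)) : Set (Cn n)) := by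
  intro w hw
  set z : Cn n := WithLp.toLp 2 w with hzdef
  rw [polyBox, Set.mem_univ_pi] at hw
  have h0 := hw 0
  rw [if_pos rfl, Complex.mem_reProdIm] at h0
  obtain ⟨⟨x1, x2⟩, ⟨y1, y2⟩⟩ := h0
  have hn : (0 : ℝ) < n := Nat.cast_pos.2 (NeZero.pos n)
  have hsum : ∑ i ∈ Finset.univ.erase 0, ‖z i‖ ^ 2 ≤ r / 20 := by
    calc ∑ i ∈ Finset.univ.erase 0, ‖z i‖ ^ 2
        ≤ ∑ i ∈ Finset.univ.erase (0 : Fin n), r / (20 * n) := by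
          refine Finset.sum_le_sum fun i hi => ?_
          have := hw i
          rw [if_neg (Finset.ne_of_mem_erase hi), mem_closedBall, dist_zero_right] at this
          calc ‖z i‖ ^ 2 ≤ Real.sqrt (r / (20 * n)) ^ 2 := by
                exact pow_le_pow_left₀ (norm_nonneg _) this 2
            _ = _ := Real.sq_sqrt (by positivity)
      _ ≤ ∑ i : Fin n, r / (20 * n) :=
          Finset.sum_le_sum_of_subset_of_nonneg (Finset.erase_subset _ _)
            fun _ _ _ => by positivity
      _ = r / 20 := by simp; field_simp
  have hsum0 : 0 ≤ ∑ i ∈ Finset.univ.erase 0, ‖z i‖ ^ 2 :=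
    Finset.sum_nonneg fun _ _ => sq_nonneg _
  have hz2 := norm_sq_eq_add_sum z
  have hz0 : ‖z 0‖ ^ 2 = (w 0).re ^ 2 + (w 0).im ^ 2 := by
    rw [Complex.sq_norm, Complex.normSq_apply]; simp [hzdef]; ring
  have hy2 : (w 0).im ^ 2 ≤ r / 400 := by nlinarith
  have hzn := norm_nonneg z
  have hzlo : (w 0).re ≤ ‖z‖ := by
    refine (abs_le_of_sq_le_sq' ?_ hzn).2
    nlinarith [sq_nonneg (w 0).im]
  have hzhi : ‖z‖ < 1 := by
    by_contra hcon
    push Not at hcon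
    nlinarith
  have hzpos : 0 < ‖z‖ := by linarith
  -- Divide the bound on `‖z‖² - (Re z₀)²` by `‖z‖ + Re z₀ ≥ 1/2`.
  have hdiff : ‖z‖ - (w 0).re ≤ 2 * (r / 400 + r / 20) := by nlinarith
  refine ⟨‖z‖, ⟨hzpos, hzhi⟩, (‖z‖⁻¹ : ℝ) • z, ⟨⟨(‖z‖⁻¹ : ℝ) • z, ?_⟩, ?_, rfl⟩, ?_⟩
  · rw [mem_sphere_zero_iff_norm, norm_smul, norm_inv, norm_norm, inv_mul_cancel₀ hzpos.ne']
  · change qdist _ _ ≤ r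
    rw [qdist, inner_pole]
    change ‖1 - ((‖z‖⁻¹ : ℝ) • z) 0‖ ≤ r
    rw [PiLp.smul_apply, Complex.real_smul]
    have e : (1 : ℂ) - ((‖z‖⁻¹ : ℝ) : ℂ) * z 0 = ((‖z‖⁻¹ : ℝ) : ℂ) * ((‖z‖ : ℂ) - z 0) := by
      have : (‖z‖ : ℂ) ≠ 0 := by exact_mod_cast hzpos.ne'
      push_cast
      field_simp
    rw [e, norm_mul, Complex.norm_real, norm_inv, norm_norm, inv_mul_le_iff₀ hzpos]
    have h3 := Complex.norm_le_abs_re_add_abs_im ((‖z‖ : ℂ) - z 0)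
    have e1 : ((‖z‖ : ℂ) - z 0).re = ‖z‖ - (w 0).re := by simp [hzdef]
    have e2 : ((‖z‖ : ℂ) - z 0).im = - (w 0).im := by simp [hzdef]
    rw [e1, e2, abs_neg, abs_of_nonneg (by linarith)] at h3
    have h4 : |(w 0).im| ≤ r / 20 := abs_le.2 ⟨y1, y2⟩
    nlinarith
  · simp only [smul_smul]
    rw [mul_inv_cancel₀ hzpos.ne', one_smul]

/-- A doubling estimate for nonisotropic balls with arbitrary centres. -/
theorem exists_sigma_nonisoBall_le (n : ℕ) [NeZero n] :
    ∃ K : NNReal, ∀ (ξ ξ' : Sph n) (r : ℝ), 0 < r → r ≤ 1 →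
      sigma n (nonisoBall ξ (200 * r)) ≤ K * sigma n (nonisoBall ξ' r) := by
  -- Comparing the outer box with the inner one, the area ratio is `800r / (r/40) = 32000` in the
  -- first coordinate and `400r / (r/(20n)) = 8000n` in each other one.
  refine ⟨(32000 * n : ℕ) ^ n, fun ξ ξ' r hr hr1 => ?_⟩
  rw [sigma_nonisoBall_eq_pole ξ, sigma_nonisoBall_eq_pole ξ', sigma, Measure.smul_apply,
    Measure.smul_apply, smul_eq_mul, smul_eq_mul,
    Measure.toSphere_apply' _ (measurableSet_nonisoBall _ _),
    Measure.toSphere_apply' _ (measurableSet_nonisoBall _ _), lebesgueCn_apply, lebesgueCn_apply]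
  have hn : (1 : ℝ) ≤ n := by exact_mod_cast NeZero.one_le
  have h1 := measure_mono (μ := (volume : Measure (Fin n → ℂ)))
    (cone_nonisoBall_subset (n := n) (r := 200 * r) (by positivity))
  have h2 := measure_mono (μ := (volume : Measure (Fin n → ℂ)))
    (polyBox_subset_cone (n := n) hr hr1)
  have h3 := volume_polyBox_le (n := n) (a := -1) (b := 1) (h := 200 * r)
    (R := Real.sqrt (2 * (200 * r))) (a' := 1 / 4) (b' := 1 / 2) (h' := r / 20)
    (R' := Real.sqrt (r / (20 * n))) (K := ((32000 * n : ℕ) : NNReal))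
    (by push_cast; nlinarith)
    (by
      rw [Real.sq_sqrt (by positivity), Real.sq_sqrt (by positivity)]
      push_cast; field_simp; norm_num)
    (by norm_num) (by norm_num) (Real.sqrt_nonneg _) (Real.sqrt_nonneg _)
  have h4 := (h1.trans h3).trans (mul_le_mul_right h2 _)
  calc _ ≤ _ := mul_le_mul_right (mul_le_mul_right h4 _) _
    _ = _ := by rw [ENNReal.coe_pow]; ring

instance isProbabilityMeasure_sigma : IsProbabilityMeasure (sigma n) := by
  have : Nontrivial (Cn n) := by
    refine ⟨(pole n : Cn n), 0, fun h => ?_⟩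
    have := (pole n).2
    rw [h] at this
    simp at this
  constructor
  rw [sigma, Measure.smul_apply, smul_eq_mul]
  exact ENNReal.inv_mul_cancel (Measure.measure_univ_ne_zero.2 (Measure.toSphere_ne_zero _)) (measure_ne_top _ _)

end BallHolder

end

/-! ### The quasimetric, discs orthogonal to a vector, and averaging over rotations. -/

noncomputable section

namespace BallHolder

variable {n : ℕ}

theorem qdist_comm (u v : Sph n) : qdist u v = qdist v u := by
  rw [qdist, qdist, ← inner_conj_symm (u : Cn n) (v : Cn n), ← RCLike.norm_conj]
  simp

theorem qdist_nonneg (u v : Sph n) : 0 ≤ qdist u v := norm_nonneg _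

theorem norm_coe_sphere (t : Sph n) : ‖(t : Cn n)‖ = 1 := by simp

theorem qdist_le_two (u v : Sph n) : qdist u v ≤ 2 := by
  have h := norm_inner_le_norm (𝕜 := ℂ) (v : Cn n) (u : Cn n)
  rw [norm_coe_sphere, norm_coe_sphere] at h
  refine (norm_sub_le _ _).trans ?_
  rw [norm_one]; linarith

theorem norm_sub_sq_le_qdist (u v : Sph n) : ‖(u : Cn n) - v‖ ^ 2 ≤ 2 * qdist u v := by
  have h := Complex.re_le_norm (1 - inner ℂ (v : Cn n) (u : Cn n))
  rw [Complex.sub_re, Complex.one_re] at h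
  rw [← norm_neg, neg_sub, norm_sub_sq (𝕜 := ℂ), norm_coe_sphere, norm_coe_sphere, qdist]
  simp only [RCLike.re_eq_complex_re]
  linarith

theorem inner_self_sphere (t : Sph n) : inner ℂ (t : Cn n) (t : Cn n) = 1 := by
  rw [inner_self_eq_norm_sq_to_K, norm_coe_sphere]; simp

/-- Up to the cross term `⟨a - b, b - c⟩` the quantities `1 - ⟨·,·⟩` add. By `norm_sub_sq_le_qdist`
the cross term is at most `2 √(d(a,b) d(b,c))`, hence at most the sum of the two distances. -/
theorem qdist_le_two_mul_add (a b c : Sph n) : qdist a c ≤ 2 * (qdist a b + qdist b c) := by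
  have e : (1 : ℂ) - inner ℂ (c : Cn n) (a : Cn n) =
      (1 - inner ℂ (b : Cn n) (a : Cn n)) + (1 - inner ℂ (c : Cn n) (b : Cn n)) +
        inner ℂ ((b : Cn n) - c) ((a : Cn n) - b) := by
    rw [inner_sub_left, inner_sub_right, inner_sub_right, inner_self_sphere]; ring
  have h1 := norm_inner_le_norm (𝕜 := ℂ) ((b : Cn n) - c) ((a : Cn n) - b)
  have h2 := norm_sub_sq_le_qdist a b
  have h3 := norm_sub_sq_le_qdist b c
  have h4 := norm_add₃_le (a := (1 : ℂ) - inner ℂ (b : Cn n) (a : Cn n))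
    (b := 1 - inner ℂ (c : Cn n) (b : Cn n)) (c := inner ℂ ((b : Cn n) - c) ((a : Cn n) - b))
  rw [← e] at h4
  unfold qdist at *
  nlinarith [sq_nonneg (‖(b : Cn n) - c‖ - ‖(a : Cn n) - b‖)]

/-- The disc through `t` in the direction orthogonal to `ξ`. -/
def orthoDisc (ξ t : Cn n) (z : ℂ) : Cn n :=
  inner ℂ ξ t • ξ + z • (t - inner ℂ ξ t • ξ)

theorem orthoDisc_zero (ξ t : Cn n) : orthoDisc ξ t 0 = inner ℂ ξ t • ξ := by
  simp [orthoDisc]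

theorem differentiable_orthoDisc (ξ t : Cn n) : Differentiable ℂ (orthoDisc ξ t) := by
  unfold orthoDisc
  fun_prop

theorem continuous_orthoDisc_uncurry (ξ : Cn n) :
    Continuous fun p : Cn n × ℂ => orthoDisc ξ p.1 p.2 := by
  unfold orthoDisc
  fun_prop

theorem norm_smul_add_sq_of_inner_eq_zero {ξ w : Cn n} (h : inner ℂ ξ w = 0) (a : ℂ) :
    ‖a • ξ + w‖ ^ 2 = ‖a‖ ^ 2 * ‖ξ‖ ^ 2 + ‖w‖ ^ 2 := by
  have := norm_add_sq_eq_norm_sq_add_norm_sq_of_inner_eq_zero (𝕜 := ℂ) (a • ξ) w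
    (by rw [inner_smul_left, h, mul_zero])
  rw [← pow_two, ← pow_two, ← pow_two, norm_smul] at this
  rw [this]; ring

/-- Admitting `ξ = 0`, where `orthoDisc 0 t z = z • t`, lets the same lemmas treat the discs through
the origin. -/
theorem inner_sub_proj {ξ : Cn n} (hξ : ‖ξ‖ = 1 ∨ ξ = 0) (t : Cn n) :
    inner ℂ ξ (t - inner ℂ ξ t • ξ) = 0 := by
  rcases hξ with h | rfl
  · rw [inner_sub_right, inner_smul_right, inner_self_eq_norm_sq_to_K, h]; simp
  · simp

theorem inner_orthoDisc {ξ : Cn n} (hξ : ‖ξ‖ = 1 ∨ ξ = 0) (t : Cn n) (z : ℂ) :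
    inner ℂ ξ (orthoDisc ξ t z) = inner ℂ ξ t := by
  rw [orthoDisc, inner_add_right, inner_smul_right, inner_smul_right, inner_sub_proj hξ]
  rcases hξ with h | rfl
  · rw [inner_self_eq_norm_sq_to_K, h]; simp
  · simp

theorem norm_orthoDisc_sq {ξ : Cn n} (hξ : ‖ξ‖ = 1 ∨ ξ = 0) (t : Cn n) (z : ℂ) :
    ‖orthoDisc ξ t z‖ ^ 2 =
      ‖inner ℂ ξ t‖ ^ 2 * ‖ξ‖ ^ 2 + ‖z‖ ^ 2 * ‖t - inner ℂ ξ t • ξ‖ ^ 2 := by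
  rw [orthoDisc, norm_smul_add_sq_of_inner_eq_zero
    (by rw [inner_smul_right, inner_sub_proj hξ, mul_zero]), norm_smul, mul_pow ‖z‖]

theorem norm_sq_eq_proj {ξ : Cn n} (hξ : ‖ξ‖ = 1 ∨ ξ = 0) (t : Cn n) :
    ‖t‖ ^ 2 = ‖inner ℂ ξ t‖ ^ 2 * ‖ξ‖ ^ 2 + ‖t - inner ℂ ξ t • ξ‖ ^ 2 := by
  have := norm_orthoDisc_sq hξ t 1
  simpa [orthoDisc] using this

theorem norm_orthoDisc_of_norm_eq_one {ξ : Cn n} (hξ : ‖ξ‖ = 1 ∨ ξ = 0) (t : Cn n) {z : ℂ}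
    (hz : ‖z‖ = 1) : ‖orthoDisc ξ t z‖ = ‖t‖ := by
  rw [← sq_eq_sq₀ (norm_nonneg _) (norm_nonneg _), norm_orthoDisc_sq hξ, hz,
    norm_sq_eq_proj hξ t]
  ring

theorem norm_orthoDisc_le {ξ : Cn n} (hξ : ‖ξ‖ = 1 ∨ ξ = 0) (t : Cn n) {z : ℂ}
    (hz : ‖z‖ ≤ 1) : ‖orthoDisc ξ t z‖ ≤ ‖t‖ := by
  rw [← sq_le_sq₀ (norm_nonneg _) (norm_nonneg _), norm_orthoDisc_sq hξ, norm_sq_eq_proj hξ t]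
  have := pow_le_one₀ (n := 2) (norm_nonneg z) hz
  nlinarith [sq_nonneg ‖t - inner ℂ ξ t • ξ‖]

theorem norm_orthoDisc_lt {ξ : Cn n} (hξ : ‖ξ‖ = 1 ∨ ξ = 0) (t : Sph n)
    (ht : ‖inner ℂ ξ (t : Cn n)‖ < 1) {z : ℂ} (hz : ‖z‖ < 1) : ‖orthoDisc ξ t z‖ < 1 := by
  have h1 := norm_sq_eq_proj hξ (t : Cn n)
  rw [norm_coe_sphere] at h1
  have hξ1 : ‖ξ‖ ≤ 1 := by
    rcases hξ with h | rfl
    · exact h.le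
    · simp
  have h2 := pow_le_one₀ (n := 2) (norm_nonneg ξ) hξ1
  have h3 := pow_lt_one₀ (norm_nonneg _) ht two_ne_zero
  have h4 := pow_lt_one₀ (norm_nonneg _) hz two_ne_zero
  rw [← sq_lt_sq₀ (norm_nonneg _) zero_le_one, norm_orthoDisc_sq hξ]
  have h5 : ‖inner ℂ ξ (t : Cn n)‖ ^ 2 * ‖ξ‖ ^ 2 < 1 := by
    nlinarith [sq_nonneg ‖inner ℂ ξ (t : Cn n)‖]
  nlinarith

theorem norm_inner_smul_le {ξ : Cn n} (hξ : ‖ξ‖ = 1 ∨ ξ = 0) (t : Cn n) :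
    ‖inner ℂ ξ t • ξ‖ ≤ ‖t‖ := by
  rw [← orthoDisc_zero]
  exact norm_orthoDisc_le hξ t (by simp)

/-- The rotation of the orthogonal complement of `ξ` by the angle `θ`. -/
theorem exists_isometry_orthoDisc {ξ : Cn n} (hξ : ‖ξ‖ = 1 ∨ ξ = 0) {z : ℂ} (hz : ‖z‖ = 1) :
    ∃ U : Cn n ≃ₗᵢ[ℂ] Cn n, ∀ t, U t = orthoDisc ξ t z := by
  let L : Cn n →ₗ[ℂ] Cn n :=
    { toFun := fun t => orthoDisc ξ t z
      map_add' := fun s t => by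
        simp only [orthoDisc, inner_add_right, add_smul, smul_add, smul_sub]; abel
      map_smul' := fun a t => by
        simp only [orthoDisc, inner_smul_right, RingHom.id_apply]
        module }
  exact ⟨LinearIsometry.toLinearIsometryEquiv
    ⟨L, fun t => norm_orthoDisc_of_norm_eq_one hξ t hz⟩ rfl, fun t => rfl⟩

/-- Slices of `f` along discs orthogonal to `ξ` whose boundary consists of points where `|f|` is
almost constant. -/
theorem orthoDisc_estimate {f : Cn n → ℂ} {m δ : ℝ} (hδ : 0 < δ) (hδm : 4 * δ ≤ m)
    (hf : DifferentiableOn ℂ f (ball 0 1)) (hfc : ContinuousOn f (closedBall 0 1))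
    (h0 : ∀ z ∈ ball (0 : Cn n) 1, f z ≠ 0)
    {ξ : Cn n} (hξ : ‖ξ‖ = 1 ∨ ξ = 0) (t : Sph n) (ht : ‖inner ℂ ξ (t : Cn n)‖ < 1)
    (hb : ∀ s : Sph n, inner ℂ ξ (s : Cn n) = inner ℂ ξ (t : Cn n) → |‖f s‖ - m| ≤ δ) :
    |‖f (inner ℂ ξ (t : Cn n) • ξ)‖ - m| ≤ δ ∧
      Real.circleAverage
        (fun z => ‖f (orthoDisc ξ t z) - f (inner ℂ ξ (t : Cn n) • ξ)‖) 0 1 ≤ 18 * δ := by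
  have hin : ∀ z ∈ ball (0 : ℂ) 1, orthoDisc ξ (t : Cn n) z ∈ ball (0 : Cn n) 1 := fun z hz => by
    rw [mem_ball_zero_iff] at hz ⊢
    exact norm_orthoDisc_lt hξ t ht hz
  have hcl : ∀ z ∈ closedBall (0 : ℂ) 1, orthoDisc ξ (t : Cn n) z ∈ closedBall (0 : Cn n) 1 :=
    fun z hz => by
      rw [mem_closedBall_zero_iff] at hz ⊢
      exact (norm_orthoDisc_le hξ t hz).trans (norm_coe_sphere t).le
  have hgd : DifferentiableOn ℂ (fun z => f (orthoDisc ξ (t : Cn n) z)) (ball 0 1) :=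
    hf.comp (differentiable_orthoDisc ξ _).differentiableOn hin
  have hgc : ContinuousOn (fun z => f (orthoDisc ξ (t : Cn n) z)) (closedBall 0 1) :=
    hfc.comp (differentiable_orthoDisc ξ _).continuous.continuousOn hcl
  have hnear := norm_near_of_norm_near_sphere (m := m) (δ := δ) (by linarith) hgd hgc
    (fun z hz => h0 _ (hin z hz)) (fun z hz => by
      rw [mem_sphere_zero_iff_norm] at hz
      exact hb ⟨orthoDisc ξ t z, by
        rw [mem_sphere_zero_iff_norm, norm_orthoDisc_of_norm_eq_one hξ _ hz, norm_coe_sphere]⟩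
        (inner_orthoDisc hξ _ z))
  have h2 := circleAverage_norm_sub_center_le hδ hδm hgd hgc hnear
  have h1 := hnear 0 (by simp)
  rw [orthoDisc_zero] at h1 h2
  exact ⟨h1, h2⟩

/-- The orbit of a point of the sphere under the rotations about `ξ`. -/
def rotate {ξ : Cn n} (hξ : ‖ξ‖ = 1 ∨ ξ = 0) (p : ℝ × Sph n) : Sph n :=
  ⟨orthoDisc ξ p.2 (circleMap 0 1 p.1), by
    rw [mem_sphere_zero_iff_norm, norm_orthoDisc_of_norm_eq_one hξ _ (by simp), norm_coe_sphere]⟩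

theorem continuous_rotate {ξ : Cn n} (hξ : ‖ξ‖ = 1 ∨ ξ = 0) : Continuous (rotate hξ) := by
  have h1 : Continuous fun p : ℝ × Sph n => ((p.2 : Cn n), circleMap 0 1 p.1) := by fun_prop
  exact ((continuous_orthoDisc_uncurry ξ).comp h1).subtype_mk _

/-- An integral over a set invariant under the rotations about `ξ` is controlled by the averages
over the orbits. -/
theorem setIntegral_le_of_circleAverage_le {ξ : Cn n} (hξ : ‖ξ‖ = 1 ∨ ξ = 0) [NeZero n]
    {T : Set ℂ} (hT : IsClosed T) {G : Cn n → ℝ} (hG : ContinuousOn G (sphere 0 1)) {K : ℝ}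
    (hK : ∀ t : Sph n, inner ℂ ξ (t : Cn n) ∈ T →
      Real.circleAverage (fun z => G (orthoDisc ξ t z)) 0 1 ≤ K) :
    ∫ t in {t : Sph n | inner ℂ ξ (t : Cn n) ∈ T}, G t ∂(sigma n) ≤
      K * (sigma n).real {t : Sph n | inner ℂ ξ (t : Cn n) ∈ T} := by
  set S := {t : Sph n | inner ℂ ξ (t : Cn n) ∈ T} with hSdef
  have hSc : IsClosed S := hT.preimage (by fun_prop)
  have hS := hSc.measurableSet
  set Φ := rotate hξ
  have hΦ : Continuous Φ := continuous_rotate hξ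
  have hGs : Continuous fun t : Sph n => G t := hG.comp_continuous continuous_subtype_val
    fun t => t.2
  have hGΦ : Continuous fun p => G (Φ p : Cn n) := hGs.comp hΦ
  obtain ⟨M, hM⟩ : ∃ M, ∀ t : Sph n, ‖G t‖ ≤ M := by
    obtain ⟨M, hM⟩ := (isCompact_range hGs.norm).bddAbove
    exact ⟨M, fun t => hM ⟨t, rfl⟩⟩
  have hinv : ∀ θ : ℝ, ∫ t in S, G (Φ (θ, t)) ∂(sigma n) = ∫ t in S, G t ∂(sigma n) := by
    intro θ
    obtain ⟨U, hU⟩ := exists_isometry_orthoDisc hξ (z := circleMap 0 1 θ) (by simp)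
    have hUΦ : ∀ t, sphereMap U t = Φ (θ, t) := fun t => Subtype.ext (hU t)
    have hpre : sphereMap U ⁻¹' S = S := by
      ext t
      simp only [hSdef, Set.mem_preimage, Set.mem_ofPred_eq, coe_sphereMap, hU,
        inner_orthoDisc hξ]
    have h := (measurePreserving_sphereMap U).map_eq
    conv_rhs => rw [← h]
    rw [setIntegral_map hS (by rw [h]; exact hGs.aestronglyMeasurable)
      (continuous_sphereMap U).aemeasurable, hpre]
    simp only [hUΦ]
  have hint : Integrable (fun p : ℝ × Sph n => G (Φ p : Cn n))
      ((volume.restrict (Set.Ioc 0 (2 * Real.pi))).prod ((sigma n).restrict S)) :=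
    Integrable.of_bound hGΦ.aestronglyMeasurable M (Filter.Eventually.of_forall fun p => hM _)
  -- Integrating over `S` first gives the same value for every angle, by `hinv`; integrating over
  -- the angle first gives the orbit averages bounded by `K`.
  have hswap := integral_integral_swap (f := fun (θ : ℝ) (t : Sph n) => G (Φ (θ, t) : Cn n)) hint
  have hpi := Real.pi_pos
  have hl : ∫ θ in Set.Ioc 0 (2 * Real.pi), ∫ t in S, G (Φ (θ, t) : Cn n) ∂(sigma n) =
      2 * Real.pi * ∫ t in S, G t ∂(sigma n) := by
    simp only [hinv]
    rw [setIntegral_const]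
    simp [hpi.le]
  have hr : ∫ t in S, (∫ θ in Set.Ioc 0 (2 * Real.pi), G (Φ (θ, t) : Cn n)) ∂(sigma n) ≤
      2 * Real.pi * K * (sigma n).real S := by
    calc _ ≤ ∫ t in S, 2 * Real.pi * K ∂(sigma n) := by
          refine setIntegral_mono_on hint.integral_prod_right (integrable_const _) hS
            fun t ht => ?_
          have h := hK t ht
          rw [Real.circleAverage_def, smul_eq_mul, inv_mul_le_iff₀ (by positivity),
            intervalIntegral.integral_of_le (by positivity)] at h
          exact h
      _ = _ := by rw [setIntegral_const, smul_eq_mul]; ring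
  rw [hl] at hswap
  rw [← hswap] at hr
  have : 2 * Real.pi * (K * (sigma n).real S) = 2 * Real.pi * K * (sigma n).real S := by ring
  rw [← this] at hr
  exact le_of_mul_le_mul_left hr (by positivity)

theorem meanOsc_le_setAverage (f : Cn n → ℂ) (Q : Set (Sph n)) (a : ℂ) :
    meanOsc f Q ≤ ⨍ z in Q, ‖f (z : Cn n) - a‖ ∂(sigma n) := by
  refine ciInf_le ⟨0, ?_⟩ a
  rintro _ ⟨b, rfl⟩
  simp only [setAverage_eq]
  exact smul_nonneg (by positivity) (integral_nonneg fun _ => norm_nonneg _)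

theorem meanOsc_le_of_forall_le [NeZero n] {f : Cn n → ℂ} {Q : Set (Sph n)} {a : ℂ} {B : ℝ}
    (hB : 0 ≤ B) (h : ∀ t ∈ Q, ‖f (t : Cn n) - a‖ ≤ B) : meanOsc f Q ≤ B := by
  refine (meanOsc_le_setAverage f Q a).trans ?_
  rw [setAverage_eq, smul_eq_mul]
  have h1 := norm_setIntegral_le_of_norm_le_const (μ := sigma n) (s := Q)
    (f := fun t : Sph n => ‖f (t : Cn n) - a‖) (C := B) (measure_lt_top _ _)
    (fun t ht => by rw [norm_norm]; exact h t ht)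
  have h2 := (Real.le_norm_self _).trans h1
  rcases eq_or_lt_of_le (measureReal_nonneg (μ := sigma n) (s := Q)) with h3 | h3
  · rw [← h3]; simpa using hB
  · rw [inv_mul_le_iff₀ h3]; linarith

/-- The constant is `42 = 18 + 24`: oscillation within each orthogonal disc plus oscillation of the
central values. `D` pays for enlarging `Q` to the invariant set. -/
theorem meanOsc_le_of_invariant_set [NeZero n] {f : Cn n → ℂ} {m δ D : ℝ} (hδ : 0 < δ)
    (hδm : 4 * δ ≤ m)
    (hf : DifferentiableOn ℂ f (ball 0 1)) (hfc : ContinuousOn f (closedBall 0 1))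
    (h0 : ∀ z ∈ ball (0 : Cn n) 1, f z ≠ 0)
    {ξ : Cn n} (hξ : ‖ξ‖ = 1 ∨ ξ = 0) {T : Set ℂ} (hT : IsClosed T)
    (hT1 : ∀ t : Sph n, inner ℂ ξ (t : Cn n) ∈ T → ‖inner ℂ ξ (t : Cn n)‖ < 1)
    (hb : ∀ t : Sph n, inner ℂ ξ (t : Cn n) ∈ T → |‖f t‖ - m| ≤ δ) {a : ℂ}
    (ha : ∀ t : Sph n, inner ℂ ξ (t : Cn n) ∈ T → ‖f (inner ℂ ξ (t : Cn n) • ξ) - a‖ ≤ 24 * δ)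
    {Q : Set (Sph n)} (hQ : Q ⊆ {t : Sph n | inner ℂ ξ (t : Cn n) ∈ T})
    (hD0 : 0 ≤ D)
    (hD : (sigma n).real {t : Sph n | inner ℂ ξ (t : Cn n) ∈ T} ≤ D * (sigma n).real Q) :
    meanOsc f Q ≤ 42 * δ * D := by
  set S := {t : Sph n | inner ℂ ξ (t : Cn n) ∈ T} with hSdef
  have hSc : IsClosed S := hT.preimage (by fun_prop)
  have hS := hSc.measurableSet
  have hfs : Continuous fun t : Sph n => f t :=
    hfc.comp_continuous continuous_subtype_val fun t => sphere_subset_closedBall t.2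
  set c : Cn n → ℂ := fun t => f (inner ℂ ξ t • ξ)
  have hc : ContinuousOn c (sphere 0 1) := by
    refine hfc.comp (by fun_prop) fun t ht => ?_
    rw [mem_sphere_zero_iff_norm] at ht
    rw [mem_closedBall_zero_iff, ← ht]
    exact norm_inner_smul_le hξ t
  have hG : ContinuousOn (fun t => ‖f t - c t‖) (sphere 0 1) :=
    ((hfc.mono sphere_subset_closedBall).sub hc).norm
  have h1 := setIntegral_le_of_circleAverage_le hξ hT hG (K := 18 * δ) (fun t ht => by
    have h := (orthoDisc_estimate hδ hδm hf hfc h0 hξ t (hT1 t ht) fun s hs => hb s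
      (by rw [hs]; exact ht)).2
    simpa only [c, inner_orthoDisc hξ] using h)
  have hcs : Continuous fun t : Sph n => c t := hc.comp_continuous continuous_subtype_val
    fun t => t.2
  have hi1 : IntegrableOn (fun t : Sph n => ‖f t - a‖) S (sigma n) :=
    ((hfs.sub continuous_const).norm.integrable_of_hasCompactSupport
      (HasCompactSupport.of_compactSpace _)).integrableOn
  have hi2 : IntegrableOn (fun t : Sph n => ‖f t - c t‖) S (sigma n) :=
    ((hfs.sub hcs).norm.integrable_of_hasCompactSupport
      (HasCompactSupport.of_compactSpace _)).integrableOn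
  have h2 : ∫ t in S, ‖f (t : Cn n) - a‖ ∂(sigma n) ≤ 42 * δ * (sigma n).real S := by
    calc _ ≤ ∫ t in S, (‖f (t : Cn n) - c t‖ + 24 * δ) ∂(sigma n) := by
          refine setIntegral_mono_on hi1 (hi2.add (integrable_const _)) hS fun t ht => ?_
          exact (norm_sub_le_norm_sub_add_norm_sub _ (c t) _).trans
            (add_le_add_right (ha t ht) _)
      _ = ∫ t in S, ‖f (t : Cn n) - c t‖ ∂(sigma n) + 24 * δ * (sigma n).real S := by
          rw [integral_add hi2 (integrable_const _), setIntegral_const, smul_eq_mul]; ring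
      _ ≤ _ := by linarith
  have h3 : ∫ t in Q, ‖f (t : Cn n) - a‖ ∂(sigma n) ≤ ∫ t in S, ‖f (t : Cn n) - a‖ ∂(sigma n) :=
    setIntegral_mono_set hi1 (Filter.Eventually.of_forall fun _ => norm_nonneg _)
      hQ.eventuallyLE
  refine (meanOsc_le_setAverage f Q a).trans ?_
  rw [setAverage_eq, smul_eq_mul]
  rcases eq_or_lt_of_le (measureReal_nonneg (μ := sigma n) (s := Q)) with h4 | h4
  · rw [← h4]; simp; positivity
  · rw [inv_mul_le_iff₀ h4]
    nlinarith [mul_le_mul_of_nonneg_left hD (by positivity : (0 : ℝ) ≤ 42 * δ)]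

end BallHolder

end

/-! ### Choice of the centre `ξ` and the Hölder bound for the mean oscillation. -/

noncomputable section

namespace BallHolder

variable {n : ℕ}

theorem norm_smul_add_smul_sq {e v : Cn n} (he : ‖e‖ = 1) (hv : ‖v‖ = 1) (hev : inner ℂ e v = 0)
    (a b : ℂ) : ‖a • e + b • v‖ ^ 2 = ‖a‖ ^ 2 + ‖b‖ ^ 2 := by
  rw [norm_smul_add_sq_of_inner_eq_zero (by rw [inner_smul_right, hev, mul_zero]), norm_smul,
    he, hv]
  ring

/-- Ensures that every `τξ` with `|τ| ≤ 1` is the centre of a disc with boundary on the sphere; the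
orthogonal unit vector `w` requires `n ≥ 2`. -/
theorem exists_inner_eq {ξ w : Sph n} (hw : inner ℂ (ξ : Cn n) (w : Cn n) = 0) {τ : ℂ}
    (hτ : ‖τ‖ ≤ 1) : ∃ t : Sph n, inner ℂ (ξ : Cn n) (t : Cn n) = τ := by
  refine ⟨⟨τ • (ξ : Cn n) + ((Real.sqrt (1 - ‖τ‖ ^ 2) : ℝ) : ℂ) • (w : Cn n), ?_⟩, ?_⟩
  · rw [mem_sphere_zero_iff_norm, ← sq_eq_sq₀ (norm_nonneg _) zero_le_one,
      norm_smul_add_smul_sq (norm_coe_sphere _) (norm_coe_sphere _) hw, Complex.norm_real,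
      Real.norm_eq_abs, sq_abs, Real.sq_sqrt]
    · ring
    · nlinarith [norm_nonneg τ]
  · simp only [inner_add_right, inner_smul_right, hw, inner_self_sphere]
    ring

variable [NeZero n]

/-- A unit vector `ξ` at prescribed distance from the pole, and a unit vector orthogonal to it. -/
theorem exists_center (hn : 2 ≤ n) {ρ : ℝ} (hρ : 0 ≤ ρ) (hρ1 : ρ ≤ 1) :
    ∃ ξ w : Sph n, inner ℂ (ξ : Cn n) (pole n : Cn n) = ((1 - ρ : ℝ) : ℂ) ∧
      inner ℂ (ξ : Cn n) (w : Cn n) = 0 := by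
  set e : Cn n := (pole n : Cn n)
  set v : Cn n := EuclideanSpace.single ⟨1, hn⟩ 1
  have he : ‖e‖ = 1 := norm_coe_sphere _
  have hv : ‖v‖ = 1 := by simp [v]
  have hev : inner ℂ e v = 0 := by
    rw [inner_pole]
    have : (0 : Fin n) ≠ ⟨1, hn⟩ := by
      intro h
      have := congrArg Fin.val h
      simp at this
    simp [v, this]
  have hve : inner ℂ v e = 0 := inner_eq_zero_symm.1 hev
  have hee : inner ℂ e e = 1 := inner_self_sphere _
  have hvv : inner ℂ v v = 1 := by rw [inner_self_eq_norm_sq_to_K, hv]; simp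
  set s := Real.sqrt (1 - (1 - ρ) ^ 2)
  have hs : s ^ 2 = 1 - (1 - ρ) ^ 2 := Real.sq_sqrt (by nlinarith)
  refine ⟨⟨((1 - ρ : ℝ) : ℂ) • e + (s : ℂ) • v, ?_⟩, ⟨(s : ℂ) • e + ((-(1 - ρ) : ℝ) : ℂ) • v, ?_⟩,
    ?_, ?_⟩
  · rw [mem_sphere_zero_iff_norm, ← sq_eq_sq₀ (norm_nonneg _) zero_le_one,
      norm_smul_add_smul_sq he hv hev, Complex.norm_real, Complex.norm_real, Real.norm_eq_abs,
      Real.norm_eq_abs, sq_abs, sq_abs, hs]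
    ring
  · rw [mem_sphere_zero_iff_norm, ← sq_eq_sq₀ (norm_nonneg _) zero_le_one,
      norm_smul_add_smul_sq he hv hev, Complex.norm_real, Complex.norm_real, Real.norm_eq_abs,
      Real.norm_eq_abs, sq_abs, sq_abs, hs]
    ring
  · simp only [inner_add_left, inner_smul_left, hee, hve, Complex.conj_ofReal]
    ring
  · simp only [inner_add_left, inner_smul_left, inner_add_right, inner_smul_right, hee, hve, hev,
      hvv, Complex.conj_ofReal]
    push_cast
    ring

theorem qdist_pole_le_of_mem {ξ t : Sph n} {r : ℝ} (hp : pole n ∈ nonisoBall ξ r)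
    (ht : t ∈ nonisoBall ξ r) : qdist t (pole n) ≤ 4 * r := by
  have h1 := qdist_le_two_mul_add t ξ (pole n)
  have h2 : qdist t ξ ≤ r := ht
  have h3 : qdist (pole n) ξ ≤ r := hp
  rw [qdist_comm] at h3
  linarith

/-- Taking `ξ` to be the pole would put the projection of `Q` at the edge of the unit disc, with no
room for Borel–Carathéodory. Tilting `ξ` puts the projection of the pole at the centre `c` of the
disc of radius `ρ = 1 - c`, which lies inside the unit disc and touches its boundary at `1`. -/
theorem meanOsc_le_of_small (hn : 2 ≤ n) {K : NNReal}
    (hK : ∀ (ξ ξ' : Sph n) (r : ℝ), 0 < r → r ≤ 1 →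
      sigma n (nonisoBall ξ (200 * r)) ≤ K * sigma n (nonisoBall ξ' r))
    {f : Cn n → ℂ} {m δ : ℝ} (hδ : 0 < δ) (hδm : 4 * δ ≤ m)
    (hf : DifferentiableOn ℂ f (ball 0 1)) (hfc : ContinuousOn f (closedBall 0 1))
    (h0 : ∀ z ∈ ball (0 : Cn n) 1, f z ≠ 0) {η : Sph n} {r : ℝ} (hr : 0 < r) (hr1 : r ≤ 1 / 100)
    (hp : pole n ∈ nonisoBall η r)
    (hb : ∀ t : Sph n, qdist t (pole n) ≤ 600 * r → |‖f t‖ - m| ≤ δ) :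
    meanOsc f (nonisoBall η r) ≤ 42 * δ * K := by
  set ρ := 100 * r with hρ
  have hρ0 : 0 < ρ := by positivity
  have hρ1 : ρ ≤ 1 := by linarith
  obtain ⟨ξ, w, hξe, hξw⟩ := exists_center (n := n) hn hρ0.le hρ1
  set c : ℂ := ((1 - ρ : ℝ) : ℂ) with hc
  have hξ : ‖(ξ : Cn n)‖ = 1 ∨ (ξ : Cn n) = 0 := Or.inl (norm_coe_sphere _)
  have hcn : ‖c‖ = 1 - ρ := by
    rw [hc, Complex.norm_real, Real.norm_eq_abs, abs_of_nonneg (by linarith)]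
  have h1c : ‖1 - c‖ = ρ := by
    rw [hc, ← Complex.ofReal_one, ← Complex.ofReal_sub, Complex.norm_real, sub_sub_cancel,
      Real.norm_eq_abs, abs_of_pos hρ0]
  have hnorm : ∀ τ : ℂ, ‖τ - c‖ < ρ → ‖τ‖ < 1 := fun τ hτ => by
    have := norm_le_norm_sub_add τ c
    linarith
  have hqξ : ∀ t : Sph n, qdist t ξ ≤ ‖inner ℂ (ξ : Cn n) (t : Cn n) - c‖ + ρ := fun t => by
    rw [qdist, ← h1c, ← norm_neg (inner ℂ (ξ : Cn n) (t : Cn n) - c)]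
    refine le_trans (le_of_eq ?_) (norm_add_le _ _)
    congr 1; ring
  have hξp : qdist (pole n) ξ = ρ := by rw [qdist, hξe, h1c]
  -- The quasi-triangle inequality gives distance at most `2(2ρ + ρ) = 600r` from the pole.
  have hb' : ∀ t : Sph n, ‖inner ℂ (ξ : Cn n) (t : Cn n) - c‖ < ρ → |‖f t‖ - m| ≤ δ :=
    fun t ht => hb t (by
      have h1 := hqξ t
      have h2 := qdist_le_two_mul_add t ξ (pole n)
      rw [qdist_comm ξ, hξp] at h2
      linarith)
  have hslice : ∀ τ ∈ ball c ρ, |‖f (τ • (ξ : Cn n))‖ - m| ≤ δ := by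
    intro τ hτ
    rw [mem_ball, dist_eq_norm] at hτ
    have hτ1 := hnorm τ hτ
    obtain ⟨t, rfl⟩ := exists_inner_eq hξw hτ1.le
    exact (orthoDisc_estimate hδ hδm hf hfc h0 hξ t hτ1
      (fun s hs => hb' s (by rw [hs]; exact hτ))).1
  have hdiff : DifferentiableOn ℂ (fun τ : ℂ => f (τ • (ξ : Cn n))) (ball c ρ) := by
    refine hf.comp (by fun_prop) fun τ hτ => ?_
    rw [mem_ball, dist_eq_norm] at hτ
    rw [mem_ball_zero_iff, norm_smul, norm_coe_sphere, mul_one]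
    exact hnorm τ hτ
  have hT : ∀ t : Sph n, inner ℂ (ξ : Cn n) (t : Cn n) ∈ closedBall c (ρ / 2) →
      ‖inner ℂ (ξ : Cn n) (t : Cn n) - c‖ ≤ ρ / 2 := fun t ht => by
    rwa [mem_closedBall, dist_eq_norm] at ht
  have hT' : ∀ t : Sph n, inner ℂ (ξ : Cn n) (t : Cn n) ∈ closedBall c (ρ / 2) →
      ‖inner ℂ (ξ : Cn n) (t : Cn n) - c‖ < ρ := fun t ht => by
    linarith [hT t ht]
  refine meanOsc_le_of_invariant_set hδ hδm hf hfc h0 hξ isClosed_closedBall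
    (fun t ht => hnorm _ (hT' t ht)) (fun t ht => hb' t (hT' t ht)) (a := f (c • (ξ : Cn n)))
    (fun t ht => norm_sub_center_le_of_norm_near hρ0 hδ hδm hdiff hslice (hT t ht)) ?_ K.2 ?_
  · intro t ht
    rw [Set.mem_ofPred_eq, mem_closedBall, dist_eq_norm]
    have h4 := qdist_pole_le_of_mem hp ht
    -- The product term is at most `40r` and the last one at most `4r`; the sum is below `ρ/2 =
    -- 50r`.
    have e : inner ℂ (ξ : Cn n) (t : Cn n) - c =
        inner ℂ ((ξ : Cn n) - pole n) ((t : Cn n) - pole n) -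
          (1 - inner ℂ (pole n : Cn n) (t : Cn n)) := by
      rw [← hξe, inner_sub_left, inner_sub_right, inner_sub_right, inner_self_sphere]; ring
    have h5 := norm_inner_le_norm (𝕜 := ℂ) ((ξ : Cn n) - pole n) ((t : Cn n) - pole n)
    have h6 := norm_sub_sq_le_qdist ξ (pole n)
    rw [qdist_comm, hξp] at h6
    have h7 := norm_sub_sq_le_qdist t (pole n)
    have h8 : ‖(ξ : Cn n) - pole n‖ * ‖(t : Cn n) - pole n‖ ≤ 40 * r := by
      apply abs_le_of_sq_le_sq' _ (by positivity) |>.2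
      rw [mul_pow]
      calc _ ≤ (2 * ρ) * (2 * (4 * r)) := by gcongr; linarith
        _ = _ := by rw [hρ]; ring
    rw [e]
    refine (norm_sub_le _ _).trans ?_
    change _ + qdist t (pole n) ≤ _
    linarith
  · have h1 : {t : Sph n | inner ℂ (ξ : Cn n) (t : Cn n) ∈ closedBall c (ρ / 2)} ⊆
        nonisoBall ξ (200 * r) := fun t ht => by
      have h2 := hqξ t
      have h3 := hT t ht
      change qdist t ξ ≤ 200 * r
      linarith
    have h2 := (measure_mono (μ := sigma n) h1).trans (hK ξ η r hr (by linarith))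
    have h3 := ENNReal.toReal_mono
      (ENNReal.mul_ne_top ENNReal.coe_ne_top (measure_ne_top _ _)) h2
    rwa [ENNReal.toReal_mul, ENNReal.coe_toReal] at h3

/-- With `ξ = 0` every disc is centred at the origin, so all central values equal `f 0`. The whole
sphere is a ball of radius `2 = 200 · (1/100)`, so the doubling estimate still applies. -/
theorem meanOsc_le_of_large {K : NNReal}
    (hK : ∀ (ξ ξ' : Sph n) (r : ℝ), 0 < r → r ≤ 1 →
      sigma n (nonisoBall ξ (200 * r)) ≤ K * sigma n (nonisoBall ξ' r))
    {f : Cn n → ℂ} {m δ : ℝ} (hδ : 0 < δ) (hδm : 4 * δ ≤ m)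
    (hf : DifferentiableOn ℂ f (ball 0 1)) (hfc : ContinuousOn f (closedBall 0 1))
    (h0 : ∀ z ∈ ball (0 : Cn n) 1, f z ≠ 0) {η : Sph n} {r : ℝ} (hr1 : 1 / 100 ≤ r)
    (hb : ∀ t : Sph n, |‖f t‖ - m| ≤ δ) :
    meanOsc f (nonisoBall η r) ≤ 42 * δ * K := by
  refine meanOsc_le_of_invariant_set hδ hδm hf hfc h0 (ξ := 0) (Or.inr rfl) isClosed_univ
    (fun t _ => by simp) (fun t _ => hb t) (a := f 0) (fun t _ => by simp; positivity)
    (fun t _ => trivial) K.2 ?_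
  have h1 : {t : Sph n | inner ℂ (0 : Cn n) (t : Cn n) ∈ Set.univ} ⊆
      nonisoBall (pole n) (200 * (1 / 100)) := fun t _ => by
    change qdist t (pole n) ≤ _
    linarith [qdist_le_two t (pole n)]
  have h4 : nonisoBall η (1 / 100) ⊆ nonisoBall η r := fun t ht => le_trans ht hr1
  have h2 := ((measure_mono (μ := sigma n) h1).trans
    (hK (pole n) η (1 / 100) (by norm_num) (by norm_num))).trans
    (mul_le_mul_right (measure_mono h4) _)
  have h3 := ENNReal.toReal_mono
    (ENNReal.mul_ne_top ENNReal.coe_ne_top (measure_ne_top _ _)) h2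
  rwa [ENNReal.toReal_mul, ENNReal.coe_toReal] at h3

/-- Keeps the constants independent of `α`. -/
theorem mul_rpow_le_mul_rpow {A r α : ℝ} (hA : 1 ≤ A) (hr : 0 ≤ r) (hα1 : α < 1) :
    (A * r) ^ α ≤ A * r ^ α := by
  rw [Real.mul_rpow (by linarith) hr]
  have := Real.rpow_le_rpow_of_exponent_le hA hα1.le
  rw [Real.rpow_one] at this
  exact mul_le_mul_of_nonneg_right this (Real.rpow_nonneg hr _)

theorem Admissible.abs_norm_sub_le {α C₀ A r : ℝ} {f : Cn n → ℂ} (hf : Admissible α C₀ f)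
    (hC₀ : 0 < C₀) (hα : 0 < α) (hα1 : α < 1) (hA : 1 ≤ A) (hr : 0 ≤ r) {t : Sph n}
    (ht : qdist t (pole n) ≤ A * r) :
    |‖f (t : Cn n)‖ - ‖f (pole n : Cn n)‖| ≤ C₀ * (A * r ^ α) :=
  (hf.holder t).trans (mul_le_mul_of_nonneg_left
    ((Real.rpow_le_rpow (qdist_nonneg _ _) ht hα.le).trans (mul_rpow_le_mul_rpow hA hr hα1))
    hC₀.le)

theorem Admissible.meanOsc_le_add {α C₀ r : ℝ} {f : Cn n → ℂ} (hf : Admissible α C₀ f)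
    (hC₀ : 0 < C₀) (hα : 0 < α) (hα1 : α < 1) (hr : 0 ≤ r) {ξ : Sph n}
    (hp : pole n ∈ nonisoBall ξ r) :
    meanOsc f (nonisoBall ξ r) ≤ C₀ * (4 * r ^ α) + ‖f (pole n : Cn n)‖ := by
  refine meanOsc_le_of_forall_le (a := 0) (by positivity) fun t ht => ?_
  have := hf.abs_norm_sub_le hC₀ hα hα1 (by norm_num) hr (qdist_pole_le_of_mem hp ht)
  rw [sub_zero]
  linarith [(abs_le.1 this).2]

/-- The mean oscillation over balls containing the pole obeys a Hölder bound. -/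
theorem Admissible.meanOsc_le (hn : 2 ≤ n) {K : NNReal}
    (hK : ∀ (ξ ξ' : Sph n) (r : ℝ), 0 < r → r ≤ 1 →
      sigma n (nonisoBall ξ (200 * r)) ≤ K * sigma n (nonisoBall ξ' r))
    {α C₀ r : ℝ} {f : Cn n → ℂ} (hf : Admissible α C₀ f)
    (hC₀ : 0 < C₀) (hα : 0 < α) (hα1 : α < 1) (hr : 0 ≤ r) {ξ : Sph n}
    (hp : pole n ∈ nonisoBall ξ r) :
    meanOsc f (nonisoBall ξ r) ≤ C₀ * (2404 + 25200 * K) * r ^ α := by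
  rcases hr.eq_or_lt with rfl | hr
  -- A ball of radius `0` containing the pole is the pole alone.
  · refine meanOsc_le_of_forall_le (a := f (pole n : Cn n)) (by positivity) fun t ht => ?_
    have h1 := qdist_pole_le_of_mem hp ht
    have h2 := norm_sub_sq_le_qdist t (pole n)
    have h3 : ‖(t : Cn n) - pole n‖ = 0 := by
      rw [← sq_eq_zero_iff]; exact le_antisymm (by linarith) (sq_nonneg _)
    rw [sub_eq_zero.1 (norm_eq_zero.1 h3), sub_self, norm_zero]
    positivity
  · have hrα : 0 < r ^ α := Real.rpow_pos_of_pos hr α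
    set m := ‖f (pole n : Cn n)‖ with hm
    set δ := C₀ * (600 * r ^ α) with hδdef
    have hδ : 0 < δ := by positivity
    have hb : ∀ t : Sph n, qdist t (pole n) ≤ 600 * r → |‖f t‖ - m| ≤ δ := fun t ht =>
      hf.abs_norm_sub_le hC₀ hα hα1 (by norm_num) hr.le ht
    have hpos : 0 ≤ C₀ * r ^ α * K := by positivity
    have hpos' : 0 ≤ C₀ * r ^ α := by positivity
    by_cases hδm : 4 * δ ≤ m
    · have key : meanOsc f (nonisoBall ξ r) ≤ 42 * δ * K := by
        rcases le_total r (1 / 100) with h | h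
        · exact meanOsc_le_of_small hn hK hδ hδm hf.holo hf.cont hf.zero_free hr h hp hb
        · exact meanOsc_le_of_large hK hδ hδm hf.holo hf.cont hf.zero_free h
            fun t => hb t (by linarith [qdist_le_two t (pole n)])
      rw [hδdef] at key
      linarith
    -- Now `m < 4δ = 2400 C₀ r^α`, and the comparison with `0` adds `4 C₀ r^α`, hence `2404`. The
    -- other case contributes `42 · 600 = 25200`.
    · push Not at hδm
      have key := hf.meanOsc_le_add hC₀ hα hα1 hr.le hp
      rw [hδdef] at hδm
      linarith

end BallHolder

end

theorem mainTheorem4 (n : ℕ) [NeZero n] (hn : 2 ≤ n) (C₀ : ℝ) (hC₀ : 0 < C₀) (B₀ : ENNReal) :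
    ∃ C : ℝ, 0 < C ∧
      ∀ α : ℝ, 0 < α → α < 1 →
      ∀ f : BallHolder.Cn n → ℂ, BallHolder.Admissible α C₀ f → BallHolder.sliceBound f = B₀ →
        (∀ (ξ : BallHolder.Sph n) (r : ℝ), 0 ≤ r →
          BallHolder.pole n ∈ BallHolder.nonisoBall ξ r →
          BallHolder.meanOsc f (BallHolder.nonisoBall ξ r) ≤
            C * r ^ α + ‖f (BallHolder.pole n : BallHolder.Cn n)‖) ∧
        (0 < ‖f (BallHolder.pole n : BallHolder.Cn n)‖ →
          ∀ (ξ : BallHolder.Sph n) (r : ℝ), 0 ≤ r →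
          BallHolder.pole n ∈ BallHolder.nonisoBall ξ r →
          r ≤ (‖f (BallHolder.pole n : BallHolder.Cn n)‖ / (2 * C₀)) ^ (1 / α) →
          BallHolder.meanOsc f (BallHolder.nonisoBall ξ r) ≤
            C * r ^ α +
              C * (r ^ 2 / ‖f (BallHolder.pole n : BallHolder.Cn n)‖ ^ (2 / α - 1))) := by
  obtain ⟨K, hK⟩ := BallHolder.exists_sigma_nonisoBall_le n
  refine ⟨C₀ * (2404 + 25200 * K), by positivity, fun α hα hα1 f hf _ =>
    ⟨fun ξ r hr hp => ?_, fun _ ξ r hr hp _ => ?_⟩⟩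
  · exact (hf.meanOsc_le hn hK hC₀ hα hα1 hr hp).trans
      (le_add_of_nonneg_right (norm_nonneg _))
  · exact (hf.meanOsc_le hn hK hC₀ hα hα1 hr hp).trans
      (le_add_of_nonneg_right (by positivity))
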